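/- Let $n \ge 3$ and $N = 4n$, and let indices $i \in [n]$ be taken modulo $n$. For bit strings $x, y \in \{0,1\}^n$ for which there is exactly one index $i$ with $x_i > y_i$, define directed graphs $G_A$, $G_B$ on the vertex set $V = [n] \times \{0,1,01,11\}$. The edges of $G_A$ are, for all $i \in [n]$: (1) $((i,1),(i+1,z))$ with $z = 0$ if $x_{i+1} = 0$ and $z = 11$ otherwise; (2) if $x_i = 0$: $((i,0),(i+1,z))$ with $z = 0$ if $x_{i+1} = 0$ and $z = 01$ otherwise; (3) if $x_i = 1$: $((i,0),(i-1,x_{i-1}))$; (4) $((i,01),(i,1))$ and $((i,11),(i,1))$. The edges of $G_B$ are, for all $i \in [n]$: (1) $((i,1),(i+1,z))$ with $z = 0$ if $y_{i+1} = 0$ and $z = 11$ otherwise; (2) $((i,0),(i+1,z))$ with $z = 0$ if $y_{i+1} = 0$ and $z = 01$ otherwise; (3) $((i,01),(i,1))$ and $((i,11),(i,1))$. The 2-cycle $N \times N$ game built from $x, y$ is the two-player game in which both players have the action set $V$, and the utilities are $u_A(u,v) = 1$ if $(v,u)$ is an edge of $G_A$ and $0$ otherwise, and $u_B(u,v) =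 1$ if $(u,v)$ is an edge of $G_B$ and $0$ otherwise. For $\varepsilon \in [0,1)$, an $\varepsilon$-approximate well-supported Nash equilibrium of the game is a pair $(a^*,b^*)$ of probability distributions on $V$ such that $\mathbb{E}_{v\sim b^*}[u_A(u',v) - u_A(u,v)] \le \varepsilon$ for all $u \in \mathrm{Supp}(a^*)$ and $u' \in V$, and $\mathbb{E}_{u\sim a^*}[u_B(u,v') - u_B(u,v)] \le \varepsilon$ for all $v \in \mathrm{Supp}(b^*)$ and $v' \in V$. In the task of finding such an equilibrium, player $A$ gets $u_A$, player $B$ gets $u_B$ (both know $n$ and $\varepsilon$), and at the end of the communication player $A$ outputs $a^*$ and player $B$ outputs $b^*$. The players may use common and private random coins, and the communication complexity of a protocol is the worst-case total number of bits exchanged. Theorem. For every $0 \le \varepsilon \le \frac1N$, every randomized communication protocol that, on every 2-cycle $N \times N$ game, finds an $\varepsilon$-approximate well-supported Nash equilibrium with error probability at most $\frac13$ has communication complexity $\Omega(N)$. That is, there are absolute constants $c > 0$ and $n_0$ such that for all $n \ge \max(3, n_0)$ and all $0 \le \varepsilon \le \frac1N$, every such protocol has communication complexity at least $cN$. -/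

import Mathlib

open MeasureTheory
open scoped ENNReal

universe u

/-! ## Two-party communication protocols -/

/-- A deterministic two-party communication protocol, as a binary tree. Player `A` holds an `x : X`,
player `B` holds a `y : Y`. At an internal node the owner of the node sends one bit that depends
on the data that the owner holds. At a leaf each player computes an output from the leaf (that is,
from the bits exchanged so far) and from the data that this player holds. -/
inductive Protocol (X Y OA OB : Type*) where
  | leaf (outA : X → OA) (outB : Y → OB) : Protocol X Y OA OB
  | sendA (bit : X → Bool) (next : Bool → Protocol X Y OA OB) : Protocol X Y OA OB
  | sendB (bit : Y → Bool) (next : Bool → Protocol X Y OA OB) : Protocol X Y OA OB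

namespace Protocol

variable {X Y OA OB : Type*}

/-- The pair of outputs of the two players on the given data. -/
def output : Protocol X Y OA OB → X → Y → OA × OB
  | leaf outA outB, x, y => (outA x, outB y)
  | sendA bit next, x, y => (next (bit x)).output x y
  | sendB bit next, x, y => (next (bit y)).output x y

/-- The total number of bits that the two players exchange on the given data. -/
def bits : Protocol X Y OA OB → X → Y → ℕ
  | leaf _ _, _, _ => 0
  | sendA bit next, x, y => (next (bit x)).bits x y + 1
  | sendB bit next, x, y => (next (bit y)).bits x y + 1

end Protocol

/-- A randomized protocol with common and private coins. The common coins select a protocol tree;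
what a player sends and outputs in it depends on the input and the private coins of that player. -/
structure RandomizedProtocol (X Y OA OB : Type*) where
  /-- Outcomes of the common coins. -/
  Ω : Type u
  /-- Outcomes of the private coins of player `A`. -/
  ΩA : Type u
  /-- Outcomes of the private coins of player `B`. -/
  ΩB : Type u
  [mΩ : MeasurableSpace Ω]
  [mΩA : MeasurableSpace ΩA]
  [mΩB : MeasurableSpace ΩB]
  /-- Law of the common coins. -/
  P : Measure Ω
  /-- Law of the private coins of player `A`. -/
  PA : Measure ΩA
  /-- Law of the private coins of player `B`. -/
  PB : Measure ΩB
  [probP : IsProbabilityMeasure P]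
  [probPA : IsProbabilityMeasure PA]
  [probPB : IsProbabilityMeasure PB]
  /-- The protocol tree selected by the common coins. -/
  tree : Ω → Protocol (X × ΩA) (Y × ΩB) OA OB

namespace RandomizedProtocol

variable {X Y OA OB : Type*}

attribute [instance] mΩ mΩA mΩB probP probPA probPB

/-- The joint law of the (independent) common coins and private coins. -/
noncomputable def coinLaw (π : RandomizedProtocol.{u} X Y OA OB) : Measure (π.Ω × π.ΩA × π.ΩB) :=
  π.P.prod (π.PA.prod π.PB)

/-- The outputs of the players on inputs `x`, `y` and coins `ω`. -/
def output (π : RandomizedProtocol.{u} X Y OA OB) (x : X) (y : Y) (ω : π.Ω × π.ΩA × π.ΩB) :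
    OA × OB :=
  (π.tree ω.1).output (x, ω.2.1) (y, ω.2.2)

/-- The number of bits exchanged on inputs `x`, `y` and coins `ω`. -/
def bits (π : RandomizedProtocol.{u} X Y OA OB) (x : X) (y : Y) (ω : π.Ω × π.ΩA × π.ΩB) : ℕ :=
  (π.tree ω.1).bits (x, ω.2.1) (y, ω.2.2)

/-- On every pair of inputs that satisfies the promise, the outputs fail to be correct for the task
with probability at most `δ`. (No measurability of the failure event is asked for; `Measure` is
applied to it as an outer measure.) -/
def Solves (π : RandomizedProtocol.{u} X Y OA OB) (promise : X → Y → Prop)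
    (correct : X → Y → OA → OB → Prop) (δ : ℝ≥0∞) : Prop :=
  ∀ x y, promise x y →
    π.coinLaw {ω | ¬ correct x y (π.output x y ω).1 (π.output x y ω).2} ≤ δ

/-- On every pair of inputs that satisfies the promise, and for all outcomes of the coins, at most
`C` bits are exchanged. -/
def UsesAtMost (π : RandomizedProtocol.{u} X Y OA OB) (promise : X → Y → Prop) (C : ℕ) : Prop :=
  ∀ x y, promise x y → ∀ ω, π.bits x y ω ≤ C

end RandomizedProtocol

/-! ## Approximate well-supported Nash equilibria -/

/-- `(a, b)` is an `ε`-approximate well-supported Nash equilibrium of the two-player game with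
utility functions `uA`, `uB`; mixed strategies are points of the standard simplex. -/
def IsApproxWSNE {U V : Type*} [Fintype U] [Fintype V] (uA uB : U → V → ℝ) (ε : ℝ)
    (a : stdSimplex ℝ U) (b : stdSimplex ℝ V) : Prop :=
  (∀ u : U, a.1 u ≠ 0 → ∀ u' : U, ∑ v, b.1 v * (uA u' v - uA u v) ≤ ε) ∧
  (∀ v : V, b.1 v ≠ 0 → ∀ v' : V, ∑ u, a.1 u * (uB u v' - uB u v) ≤ ε)

/-! ## The 2-cycle game -/

namespace TwoCycle

/-- The labels `0`, `1`, `01`, `11`. -/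
inductive Label where
  | l0 | l1 | l01 | l11
  deriving DecidableEq

instance : Fintype Label where
  elems := {.l0, .l1, .l01, .l11}
  complete := by intro z; cases z <;> decide

/-- The vertices `(i, z)`, with indices taken modulo `n`. They are the actions of both players, so
that the game is an `N × N` game with `N = 4 * n`. -/
abbrev Vertex (n : ℕ) := ZMod n × Label

open Label

/-- A bit as a label. -/
def bitLabel (c : Bool) : Label := if c then l1 else l0

variable {n : ℕ}

/-- The edges of the graph `G_A` of the string `x`. -/
def edgesA (x : ZMod n → Bool) : Set (Vertex n × Vertex n) :=
  {e | ∃ i, e = ((i, l1), (i + 1, if x (i + 1) then l11 else l0))} ∪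
  {e | ∃ i, x i = false ∧ e = ((i, l0), (i + 1, if x (i + 1) then l01 else l0))} ∪
  {e | ∃ i, x i = true ∧ e = ((i, l0), (i - 1, bitLabel (x (i - 1))))} ∪
  {e | ∃ i, e = ((i, l01), (i, l1)) ∨ e = ((i, l11), (i, l1))}

/-- The edges of the graph `G_B` of the string `y`. -/
def edgesB (y : ZMod n → Bool) : Set (Vertex n × Vertex n) :=
  {e | ∃ i, e = ((i, l1), (i + 1, if y (i + 1) then l11 else l0))} ∪
  {e | ∃ i, e = ((i, l0), (i + 1, if y (i + 1) then l01 else l0))} ∪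
  {e | ∃ i, e = ((i, l01), (i, l1)) ∨ e = ((i, l11), (i, l1))}

open Classical in
/-- The utility function of player `A`: it is `1` if `(v, u)` is an edge of `G_A`, else `0`. -/
noncomputable def utilityA (x : ZMod n → Bool) (u v : Vertex n) : ℝ :=
  if (v, u) ∈ edgesA x then 1 else 0

open Classical in
/-- The utility function of player `B`: it is `1` if `(u, v)` is an edge of `G_B`, else `0`. -/
noncomputable def utilityB (y : ZMod n → Bool) (u v : Vertex n) : ℝ :=
  if (u, v) ∈ edgesB y then 1 else 0

/-- `uA`, `uB` are the utility functions of a 2-cycle game, that is, of the game built from two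
strings `x`, `y` for which there is exactly one index `i` with `x i = 1` and `y i = 0`. -/
def IsGame (n : ℕ) (uA uB : Vertex n → Vertex n → ℝ) : Prop :=
  ∃ x y : ZMod n → Bool, (∃! i, x i = true ∧ y i = false) ∧ uA = utilityA x ∧ uB = utilityB y

end TwoCycle

/-! The bound reduces finding the unique common element of two sets to finding an equilibrium.

Game side: every vertex has one out-edge in each graph, so a payoff is the mass of a push-forward
along `succA` or `succB`. Some vertex has no in-edge, hence the best payoff exceeds 1/N and every
action in a support is the successor of one in the opponent's support. Comparing cardinalities, the
composite successor map is injective on the support of `a`. If the pair of bits before the special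
index i is (0,1), this map fixes (i-1, 0) and drives every supported vertex to it, so `a` reveals i
(`eq_of_isApproxWSNE`). Interleaving an instance with constant pairs (0,1), and negating the second
set, ensures this pattern.

Communication side (`sum_card_found_le`): split uniform bits z between the players by a uniform d,
which gives disjoint sets, then plant a common element j. By the rectangle property, planting j in
both sets moves the leaf distribution, in squared Hellinger distance, only as far as passing from
one player holding j to the other holding it. The triangle inequality reduces this to the influence
of one bit of z on the leaf; by the level-one inequality and the entropy bound these influences sum
to O(log #leaves). Without the planted element a leaf can name only one j, so naming j for most j
needs linearly many bits. -/

namespace UniqueIntersection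

/-! ### Influence of single bits on a function with few values. -/

open Finset

variable {ι L : Type*} [Fintype ι] [DecidableEq ι]

/-- The sign of a bit. -/
def sign (b : Bool) : ℝ := if b then 1 else -1

/-- The sum factors over coordinates, and cosh t ≤ exp (t² / 2) bounds each factor. -/
lemma sum_exp_sign (v : ι → ℝ) :
    ∑ z : ι → Bool, Real.exp (∑ j, v j * sign (z j)) ≤
      Fintype.card (ι → Bool) * Real.exp ((∑ j, v j ^ 2) / 2) := by
  have h1 : ∑ z : ι → Bool, Real.exp (∑ j, v j * sign (z j))
      = ∏ j, ∑ b : Bool, Real.exp (v j * sign b) := by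
    rw [Finset.prod_univ_sum, Fintype.piFinset_univ]
    exact Finset.sum_congr rfl fun z _ => Real.exp_sum _ _
  have h2 : (Fintype.card (ι → Bool) : ℝ) * Real.exp ((∑ j, v j ^ 2) / 2)
      = ∏ j, (2 * Real.exp (v j ^ 2 / 2)) := by
    rw [Finset.prod_mul_distrib, ← Real.exp_sum, Finset.sum_div]
    simp
  rw [h1, h2]
  refine Finset.prod_le_prod (fun j _ => Finset.sum_nonneg fun b _ => (Real.exp_pos _).le)
    fun j _ => ?_
  have := Real.cosh_le_exp_half_sq (v j)
  rw [Real.cosh_eq] at this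
  simp [sign]
  linarith

/-- The level-one inequality: a set of density `p` has squared biases that sum to at most
`2 log (1 / p)`. -/
lemma sum_sq_bias_le (S : Finset (ι → Bool)) (hS : S.Nonempty) :
    ∑ j, ((∑ z ∈ S, sign (z j)) / #S) ^ 2 ≤
      2 * Real.log (Fintype.card (ι → Bool) / #S) := by
  have hpos : (0 : ℝ) < #S := by exact_mod_cast hS.card_pos
  set v : ι → ℝ := fun j => (∑ z ∈ S, sign (z j)) / #S with hv
  set c : ℝ := ∑ j, v j ^ 2 with hc
  have hmean : ∑ z ∈ S, ∑ j, v j * sign (z j) = #S * c := by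
    rw [Finset.sum_comm, hc, Finset.mul_sum]
    refine Finset.sum_congr rfl fun j _ => ?_
    rw [← Finset.mul_sum]
    have : ∑ z ∈ S, sign (z j) = #S * v j := by rw [hv]; field_simp
    rw [this]; ring
  have hlow : #S * Real.exp c ≤ ∑ z ∈ S, Real.exp (∑ j, v j * sign (z j)) := by
    -- Jensen's inequality on S, through the tangent of exp at the mean c.
    have : ∀ z ∈ S, Real.exp c * (1 + (∑ j, v j * sign (z j)) - c) ≤
        Real.exp (∑ j, v j * sign (z j)) := fun z _ => by
      have h := Real.add_one_le_exp ((∑ j, v j * sign (z j)) - c)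
      calc _ ≤ Real.exp c * Real.exp ((∑ j, v j * sign (z j)) - c) := by
            refine mul_le_mul_of_nonneg_left ?_ (Real.exp_pos _).le
            linarith
        _ = _ := by rw [← Real.exp_add]; congr 1; ring
    refine le_trans (le_of_eq ?_) (Finset.sum_le_sum this)
    rw [← Finset.mul_sum, Finset.sum_sub_distrib, Finset.sum_add_distrib, hmean]
    simp
    ring
  have hup : ∑ z ∈ S, Real.exp (∑ j, v j * sign (z j)) ≤
      Fintype.card (ι → Bool) * Real.exp (c / 2) :=
    (Finset.sum_le_sum_of_subset_of_nonneg (Finset.subset_univ S)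
      fun _ _ _ => (Real.exp_pos _).le).trans (sum_exp_sign v)
  have hle : Real.exp (c / 2) ≤ Fintype.card (ι → Bool) / #S := by
    rw [le_div_iff₀ hpos]
    have h := hlow.trans hup
    have e : Real.exp c = Real.exp (c / 2) * Real.exp (c / 2) := by
      rw [← Real.exp_add]; congr 1; ring
    rw [e] at h
    have := Real.exp_pos (c / 2)
    exact le_of_mul_le_mul_right (by linarith) this
  have := (Real.le_log_iff_exp_le (lt_of_lt_of_le (Real.exp_pos _) hle)).2 hle
  linarith

/-- Flipping one coordinate. -/
def flip (j : ι) : Equiv.Perm (ι → Bool) :=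
  Function.Involutive.toPerm (fun z => Function.update z j (!z j)) fun z => by simp

omit [Fintype ι] in
lemma flip_apply (j : ι) (z : ι → Bool) : flip j z = Function.update z j (!z j) := rfl

lemma sum_update_add_sum_update (G : (ι → Bool) → ℝ) (j : ι) :
    ∑ z, G (Function.update z j true) + ∑ z, G (Function.update z j false) = 2 * ∑ z, G z := by
  have h : ∑ z, G (flip j z) = ∑ z, G z := Equiv.sum_comp (flip j) G
  rw [two_mul]
  nth_rewrite 2 [← h]
  rw [← Finset.sum_add_distrib, ← Finset.sum_add_distrib]
  refine Finset.sum_congr rfl fun z _ => ?_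
  rw [flip_apply]
  have h1 := Function.update_eq_self j z
  cases hz : z j <;> rw [hz] at h1 <;> simp [h1, add_comm]

lemma sq_sqrt_sub_sqrt_le {p q : ℝ} (hp : 0 ≤ p) (hq : 0 ≤ q) :
    (p + q) * (√p - √q) ^ 2 ≤ (p - q) ^ 2 := by
  have hp' := Real.sq_sqrt hp
  have hq' := Real.sq_sqrt hq
  have e : (p - q) ^ 2 = (√p + √q) ^ 2 * (√p - √q) ^ 2 := by
    rw [← mul_pow, ← sq_sub_sq, hp', hq']
  rw [e]
  refine mul_le_mul_of_nonneg_right ?_ (sq_nonneg _)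
  nlinarith [Real.sqrt_nonneg p, Real.sqrt_nonneg q, mul_nonneg (Real.sqrt_nonneg p) (Real.sqrt_nonneg q)]

variable [Fintype L] [DecidableEq L]

/-- The number of points that `F` maps to `ℓ` after the coordinate `j` is set to `b`. -/
def restrictedCount (F : (ι → Bool) → L) (j : ι) (b : Bool) (ℓ : L) : ℝ :=
  ∑ z, if F (Function.update z j b) = ℓ then 1 else 0

omit [Fintype L] in
lemma restrictedCount_nonneg (F : (ι → Bool) → L) (j : ι) (b : Bool) (ℓ : L) :
    0 ≤ restrictedCount F j b ℓ :=
  Finset.sum_nonneg fun _ _ => by split_ifs <;> norm_num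

-- With S the fiber, the two counts have sum 2 #S and difference twice the sum of signs over S. So
-- each term is at most 2 #S times a squared bias, and the level-one inequality applies.
omit [Fintype L] in
lemma sum_hellinger_fiber_le (F : (ι → Bool) → L) (ℓ : L) :
    ∑ j, (√(restrictedCount F j true ℓ) - √(restrictedCount F j false ℓ)) ^ 2 ≤
      4 * (#{z | F z = ℓ} * Real.log (Fintype.card (ι → Bool) / #{z | F z = ℓ})) := by
  set S : Finset (ι → Bool) := {z | F z = ℓ} with hSdef
  have hadd : ∀ j, restrictedCount F j true ℓ + restrictedCount F j false ℓ = 2 * #S := fun j => by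
    have := sum_update_add_sum_update (fun z => if F z = ℓ then (1 : ℝ) else 0) j
    rw [restrictedCount, restrictedCount, this, Finset.sum_boole]
  have hsub : ∀ j, restrictedCount F j true ℓ - restrictedCount F j false ℓ =
      2 * ∑ z ∈ S, sign (z j) := fun j => by
    have := sum_update_add_sum_update (fun z => sign (z j) * if F z = ℓ then (1 : ℝ) else 0) j
    rw [hSdef, Finset.sum_filter]
    simp only [mul_ite, mul_one, mul_zero] at this
    rw [← this, restrictedCount, restrictedCount, sub_eq_add_neg, ← Finset.sum_neg_distrib]
    congr 1 <;> refine Finset.sum_congr rfl fun z _ => ?_ <;> simp [sign]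
    split_ifs <;> simp
  rcases S.eq_empty_or_nonempty with hS | hS
  · have : ∀ j b, restrictedCount F j b ℓ = 0 := fun j b => by
      have h1 := restrictedCount_nonneg F j true ℓ
      have h2 := restrictedCount_nonneg F j false ℓ
      have h3 := hadd j
      rw [hS] at h3
      simp at h3
      cases b <;> linarith
    simp [this, hS]
  · have hpos : (0 : ℝ) < #S := by exact_mod_cast hS.card_pos
    have hj : ∀ j, (√(restrictedCount F j true ℓ) - √(restrictedCount F j false ℓ)) ^ 2 ≤
        2 * #S * ((∑ z ∈ S, sign (z j)) / #S) ^ 2 := fun j => by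
      have := sq_sqrt_sub_sqrt_le (restrictedCount_nonneg F j true ℓ)
        (restrictedCount_nonneg F j false ℓ)
      rw [hadd, hsub] at this
      have e : 2 * #S * ((∑ z ∈ S, sign (z j)) / #S) ^ 2
          = (2 * ∑ z ∈ S, sign (z j)) ^ 2 / (2 * #S) := by field_simp
      rw [e, le_div_iff₀ (by positivity)]
      linarith
    calc _ ≤ ∑ j, 2 * #S * ((∑ z ∈ S, sign (z j)) / #S) ^ 2 := Finset.sum_le_sum fun j _ => hj j
      _ = 2 * #S * ∑ j, ((∑ z ∈ S, sign (z j)) / #S) ^ 2 := by rw [Finset.mul_sum]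
      _ ≤ 2 * #S * (2 * Real.log (Fintype.card (ι → Bool) / #S)) :=
        mul_le_mul_of_nonneg_left (sum_sq_bias_le S hS) (by positivity)
      _ = _ := by ring

-- Entropy is at most the log of the number of values; log t ≤ t - 1 is used termwise.
omit [DecidableEq L] in
lemma sum_mul_log_le {w : L → ℝ} {N : ℝ} (hN : 0 < N) (hw : ∀ ℓ, 0 ≤ w ℓ) (hsum : ∑ ℓ, w ℓ = N) :
    ∑ ℓ, w ℓ * Real.log (N / w ℓ) ≤ N * Real.log (Fintype.card L) := by
  have : Nonempty L := by
    by_contra h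
    rw [not_nonempty_iff] at h
    simp at hsum
    linarith
  have hL : (0 : ℝ) < Fintype.card L := by exact_mod_cast Fintype.card_pos
  have h : ∀ ℓ, w ℓ * Real.log (N / w ℓ) ≤
      N / Fintype.card L - w ℓ + w ℓ * Real.log (Fintype.card L) := fun ℓ => by
    rcases (hw ℓ).eq_or_lt with h0 | h0
    · rw [← h0]; simp; positivity
    · have h1 := Real.log_le_sub_one_of_pos (x := N / w ℓ / Fintype.card L) (by positivity)
      rw [Real.log_div (by positivity) hL.ne'] at h1
      have h2 := mul_le_mul_of_nonneg_left h1 h0.le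
      have e : w ℓ * (N / w ℓ / Fintype.card L - 1) = N / Fintype.card L - w ℓ := by
        field_simp
      rw [e] at h2
      linarith
  refine (Finset.sum_le_sum fun ℓ _ => h ℓ).trans (le_of_eq ?_)
  rw [Finset.sum_add_distrib, Finset.sum_sub_distrib, ← Finset.sum_mul, hsum]
  simp
  field_simp
  ring

lemma sum_card_fiber (F : (ι → Bool) → L) :
    ∑ ℓ, (#{z | F z = ℓ} : ℝ) = Fintype.card (ι → Bool) := by
  have := Finset.card_eq_sum_card_fiberwise (f := F) (s := univ) (t := univ) (fun _ _ => by simp)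
  rw [← Finset.card_univ, this]
  push_cast
  rfl

lemma sum_hellinger_le (F : (ι → Bool) → L) :
    ∑ j, ∑ ℓ, (√(restrictedCount F j true ℓ) - √(restrictedCount F j false ℓ)) ^ 2 ≤
      4 * (Fintype.card (ι → Bool) * Real.log (Fintype.card L)) := by
  rw [Finset.sum_comm]
  refine (Finset.sum_le_sum fun ℓ _ => sum_hellinger_fiber_le F ℓ).trans ?_
  rw [← Finset.mul_sum]
  exact mul_le_mul_of_nonneg_left (sum_mul_log_le (by exact_mod_cast Fintype.card_pos)
    (fun _ => Nat.cast_nonneg _) (sum_card_fiber F)) (by norm_num)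

/-- Functions of complementary sets of independent uniform bits are independent. -/
lemma sum_mul_sum_eq (d : ι → Bool) (F G : (ι → Bool) → ℝ)
    (hF : ∀ z z', (∀ k, d k = true → z k = z' k) → F z = F z')
    (hG : ∀ z z', (∀ k, d k = false → z k = z' k) → G z = G z') :
    (∑ z, F z) * ∑ z, G z = Fintype.card (ι → Bool) * ∑ z, F z * G z := by
  -- Exchange the coordinates outside d between two independent copies: then both factors read the
  -- first copy.
  let e : Equiv.Perm ((ι → Bool) × (ι → Bool)) := Function.Involutive.toPerm
    (fun p => (fun k => if d k then p.1 k else p.2 k, fun k => if d k then p.2 k else p.1 k))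
    fun p => by ext k <;> simp <;> split_ifs <;> rfl
  rw [Finset.sum_mul_sum, ← Fintype.sum_prod_type' (f := fun z z' => F z * G z')]
  have h : ∑ p : (ι → Bool) × (ι → Bool), F p.1 * G p.2 =
      ∑ p : (ι → Bool) × (ι → Bool), F (e p).1 * G (e p).1 := by
    refine Finset.sum_congr rfl fun p _ => ?_
    congr 1
    · exact hF _ _ fun k hk => by simp [e, Function.Involutive.toPerm, hk]
    · exact hG _ _ fun k hk => by simp [e, Function.Involutive.toPerm, hk]
  rw [h, Equiv.sum_comp e (fun p => F p.1 * G p.1), Fintype.sum_prod_type_right]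
  simp

end UniqueIntersection

/-! ### Planting a common element in disjoint sets. -/

namespace UniqueIntersection

open Finset

variable {ι L : Type*} [Fintype ι] [DecidableEq ι] [Fintype L] [DecidableEq L]

/-- The coordinates of `z` that `d` assigns to the first player. -/
def fstPart (d z : ι → Bool) : ι → Bool := fun k => d k && z k

/-- The coordinates of `z` that `d` assigns to the second player. -/
def sndPart (d z : ι → Bool) : ι → Bool := fun k => !d k && z k

/-- The number of `z` for which the two parts of `z`, with their `j`-th bits set to `a` and `b`,
reach the leaf `ℓ`. -/
def leafCount (leaf : (ι → Bool) → (ι → Bool) → L) (j : ι) (d : ι → Bool) (a b : Bool) (ℓ : L) :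
    ℝ :=
  ∑ z, if leaf (Function.update (fstPart d z) j a) (Function.update (sndPart d z) j b) = ℓ
    then 1 else 0

variable (leaf : (ι → Bool) → (ι → Bool) → L)

omit [Fintype L] in
lemma leafCount_nonneg (j : ι) (d : ι → Bool) (a b : Bool) (ℓ : L) :
    0 ≤ leafCount leaf j d a b ℓ :=
  Finset.sum_nonneg fun _ _ => by split_ifs <;> norm_num

lemma sum_leafCount (j : ι) (d : ι → Bool) (a b : Bool) :
    ∑ ℓ, leafCount leaf j d a b ℓ = Fintype.card (ι → Bool) := by
  unfold leafCount
  rw [Finset.sum_comm]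
  simp

-- The bit `d j` only decides which part receives `z j`, and position j is overwritten in both
-- parts.
omit [Fintype L] in
lemma leafCount_flip (j : ι) (d : ι → Bool) (a b : Bool) (ℓ : L) :
    leafCount leaf j (flip j d) a b ℓ = leafCount leaf j d a b ℓ := by
  have h1 : ∀ z, Function.update (fstPart (flip j d) z) j a = Function.update (fstPart d z) j a :=
    fun z => by
      ext k
      by_cases hk : k = j
      · subst hk; simp
      · simp [hk, fstPart, flip_apply]
  have h2 : ∀ z, Function.update (sndPart (flip j d) z) j b = Function.update (sndPart d z) j b :=
    fun z => by
      ext k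
      by_cases hk : k = j
      · subst hk; simp
      · simp [hk, sndPart, flip_apply]
  simp only [leafCount, h1, h2]

-- Here the second part is already false at j, so planting b in the first part amounts to setting `z
-- j`.
omit [Fintype L] in
lemma leafCount_of_true {j : ι} {d : ι → Bool} (hd : d j = true) (b : Bool) (ℓ : L) :
    leafCount leaf j d b false ℓ =
      restrictedCount (fun z => leaf (fstPart d z) (sndPart d z)) j b ℓ := by
  refine Finset.sum_congr rfl fun z _ => ?_
  have h1 : Function.update (fstPart d z) j b = fstPart d (Function.update z j b) := by
    ext k
    by_cases hk : k = j
    · subst hk; simp [fstPart, hd]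
    · simp [hk, fstPart]
  have h2 : Function.update (sndPart d z) j false = sndPart d (Function.update z j b) := by
    ext k
    by_cases hk : k = j
    · subst hk; simp [sndPart, hd]
    · simp [hk, sndPart]
  rw [h1, h2]

omit [Fintype L] in
lemma leafCount_of_false {j : ι} {d : ι → Bool} (hd : d j = false) (b : Bool) (ℓ : L) :
    leafCount leaf j d false b ℓ =
      restrictedCount (fun z => leaf (fstPart d z) (sndPart d z)) j b ℓ := by
  refine Finset.sum_congr rfl fun z _ => ?_
  have h1 : Function.update (fstPart d z) j false = fstPart d (Function.update z j b) := by
    ext k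
    by_cases hk : k = j
    · subst hk; simp [fstPart, hd]
    · simp [hk, fstPart]
  have h2 : Function.update (sndPart d z) j b = sndPart d (Function.update z j b) := by
    ext k
    by_cases hk : k = j
    · subst hk; simp [sndPart, hd]
    · simp [hk, sndPart]
  rw [h1, h2]

omit [Fintype L] in
lemma leafCount_false_false_le (j : ι) (d : ι → Bool) (ℓ : L) :
    leafCount leaf j d false false ℓ ≤ 2 * #{z | leaf (fstPart d z) (sndPart d z) = ℓ} := by
  have h : leafCount leaf j d false false ℓ =
      restrictedCount (fun z => leaf (fstPart d z) (sndPart d z)) j false ℓ := by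
    cases hd : d j
    · exact leafCount_of_false leaf hd false ℓ
    · exact leafCount_of_true leaf hd false ℓ
  have h1 := sum_update_add_sum_update
    (fun z => if leaf (fstPart d z) (sndPart d z) = ℓ then (1 : ℝ) else 0) j
  have h2 := restrictedCount_nonneg (fun z => leaf (fstPart d z) (sndPart d z)) j true ℓ
  rw [h, ← Finset.sum_boole, ← h1, restrictedCount]
  rw [restrictedCount] at h2
  linarith

variable {leaf} {A B : L → (ι → Bool) → Prop}

omit [Fintype L] in
/-- The cut-and-paste property of rectangles. -/
lemma leafCount_mul_leafCount (hleaf : ∀ x y ℓ, leaf x y = ℓ ↔ A ℓ x ∧ B ℓ y)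
    (j : ι) (d : ι → Bool) (ℓ : L) :
    leafCount leaf j d true true ℓ * leafCount leaf j d false false ℓ =
      leafCount leaf j d true false ℓ * leafCount leaf j d false true ℓ := by
  classical
  set N : ℝ := ((Fintype.card (ι → Bool) : ℕ) : ℝ) with hN
  have hNpos : 0 < N := by rw [hN]; exact_mod_cast Fintype.card_pos
  let P : Bool → ℝ := fun a => ∑ z, if A ℓ (Function.update (fstPart d z) j a) then 1 else 0
  let Q : Bool → ℝ := fun b => ∑ z, if B ℓ (Function.update (sndPart d z) j b) then 1 else 0
  -- Given d, the two parts depend on complementary bits of z, so the two rectangle conditions are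
  -- independent.
  have key : ∀ a b, P a * Q b = N * leafCount leaf j d a b ℓ := fun a b => by
    rw [hN]
    refine (sum_mul_sum_eq d _ _ (fun z z' h => ?_) fun z z' h => ?_).trans ?_
    · have : fstPart d z = fstPart d z' := by
        ext k
        cases hk : d k
        · simp [fstPart, hk]
        · simp [fstPart, hk, h k hk]
      rw [this]
    · have : sndPart d z = sndPart d z' := by
        ext k
        cases hk : d k
        · simp [sndPart, hk, h k hk]
        · simp [sndPart, hk]
      rw [this]
    · congr 1
      refine Finset.sum_congr rfl fun z _ => ?_
      simp only [hleaf, ite_and]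
      split_ifs <;> simp
  have h1 := key true true
  have h2 := key false false
  have h3 := key true false
  have h4 := key false true
  have : N ^ 2 * (leafCount leaf j d true true ℓ * leafCount leaf j d false false ℓ) =
      N ^ 2 * (leafCount leaf j d true false ℓ * leafCount leaf j d false true ℓ) := by
    calc _ = (N * leafCount leaf j d true true ℓ) * (N * leafCount leaf j d false false ℓ) := by
            ring
      _ = (N * leafCount leaf j d true false ℓ) * (N * leafCount leaf j d false true ℓ) := by
            rw [← h1, ← h2, ← h3, ← h4]; ring
      _ = _ := by ring
  exact mul_left_cancel₀ (by positivity) this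

omit [DecidableEq L] in
lemma sum_sq_sqrt_sub_sqrt {p q : L → ℝ} (hp : ∀ ℓ, 0 ≤ p ℓ) (hq : ∀ ℓ, 0 ≤ q ℓ) :
    ∑ ℓ, (√(p ℓ) - √(q ℓ)) ^ 2 = ∑ ℓ, p ℓ + ∑ ℓ, q ℓ - 2 * ∑ ℓ, √(p ℓ * q ℓ) := by
  rw [Finset.mul_sum, ← Finset.sum_add_distrib, ← Finset.sum_sub_distrib]
  refine Finset.sum_congr rfl fun ℓ _ => ?_
  rw [sub_sq, Real.sq_sqrt (hp ℓ), Real.sq_sqrt (hq ℓ), Real.sqrt_mul (hp ℓ)]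
  ring

lemma sum_hellinger_diagonal_eq (hleaf : ∀ x y ℓ, leaf x y = ℓ ↔ A ℓ x ∧ B ℓ y)
    (j : ι) (d : ι → Bool) :
    ∑ ℓ, (√(leafCount leaf j d true true ℓ) - √(leafCount leaf j d false false ℓ)) ^ 2 =
      ∑ ℓ, (√(leafCount leaf j d true false ℓ) - √(leafCount leaf j d false true ℓ)) ^ 2 := by
  rw [sum_sq_sqrt_sub_sqrt (leafCount_nonneg leaf j d _ _) (leafCount_nonneg leaf j d _ _),
    sum_sq_sqrt_sub_sqrt (leafCount_nonneg leaf j d _ _) (leafCount_nonneg leaf j d _ _)]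
  simp only [sum_leafCount, leafCount_mul_leafCount hleaf]

lemma sq_sub_le (a b c : ℝ) : (a - b) ^ 2 ≤ 2 * ((a - c) ^ 2 + (b - c) ^ 2) := by
  nlinarith [sq_nonneg (a + b - 2 * c)]

/-- After cut-and-paste, the triangle inequality through (false, false) leaves two terms. One is the
influence of bit j for d, the other for `flip j d`, so summing over d recombines them. -/
lemma hellinger_diagonal_le (hleaf : ∀ x y ℓ, leaf x y = ℓ ↔ A ℓ x ∧ B ℓ y) (j : ι) :
    ∑ d, ∑ ℓ, (√(leafCount leaf j d true true ℓ) - √(leafCount leaf j d false false ℓ)) ^ 2 ≤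
      4 * ∑ d, ∑ ℓ,
        (√(restrictedCount (fun z => leaf (fstPart d z) (sndPart d z)) j true ℓ) -
          √(restrictedCount (fun z => leaf (fstPart d z) (sndPart d z)) j false ℓ)) ^ 2 := by
  set T : (ι → Bool) → ℝ := fun d => ∑ ℓ,
        (√(restrictedCount (fun z => leaf (fstPart d z) (sndPart d z)) j true ℓ) -
          √(restrictedCount (fun z => leaf (fstPart d z) (sndPart d z)) j false ℓ)) ^ 2 with hT
  have htrue : ∀ d, d j = true → T d =
      ∑ ℓ, (√(leafCount leaf j d true false ℓ) - √(leafCount leaf j d false false ℓ)) ^ 2 :=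
    fun d hd => by simp only [hT, leafCount_of_true leaf hd]
  have hfalse : ∀ d, d j = false → T d =
      ∑ ℓ, (√(leafCount leaf j d false true ℓ) - √(leafCount leaf j d false false ℓ)) ^ 2 :=
    fun d hd => by simp only [hT, leafCount_of_false leaf hd]
  have hpair : ∀ d, T d + T (flip j d) =
      ∑ ℓ, ((√(leafCount leaf j d true false ℓ) - √(leafCount leaf j d false false ℓ)) ^ 2 +
        (√(leafCount leaf j d false true ℓ) - √(leafCount leaf j d false false ℓ)) ^ 2) :=
    fun d => by
      rw [Finset.sum_add_distrib]
      cases hd : d j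
      · rw [hfalse d hd, htrue (flip j d) (by simp [flip_apply, hd])]
        simp only [leafCount_flip]
        ring
      · rw [htrue d hd, hfalse (flip j d) (by simp [flip_apply, hd])]
        simp only [leafCount_flip]
  have hflip : ∑ d, T (flip j d) = ∑ d, T d := Equiv.sum_comp (flip j) T
  have h4 : 4 * ∑ d, T d = ∑ d, 2 * (T d + T (flip j d)) := by
    rw [← Finset.mul_sum, Finset.sum_add_distrib, hflip]; ring
  rw [h4]
  refine Finset.sum_le_sum fun d _ => ?_
  rw [sum_hellinger_diagonal_eq hleaf, hpair, Finset.mul_sum]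
  exact Finset.sum_le_sum fun ℓ _ => sq_sub_le _ _ _

lemma sum_sum_hellinger_diagonal_le (hleaf : ∀ x y ℓ, leaf x y = ℓ ↔ A ℓ x ∧ B ℓ y) :
    ∑ j, ∑ d, ∑ ℓ,
        (√(leafCount leaf j d true true ℓ) - √(leafCount leaf j d false false ℓ)) ^ 2 ≤
      16 * ((Fintype.card (ι → Bool) : ℝ) ^ 2 * Real.log (Fintype.card L)) := by
  refine (Finset.sum_le_sum fun j _ => hellinger_diagonal_le hleaf j).trans ?_
  rw [← Finset.mul_sum, Finset.sum_comm]
  refine (mul_le_mul_of_nonneg_left (Finset.sum_le_sum fun d _ => sum_hellinger_le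
    (fun z => leaf (fstPart d z) (sndPart d z))) (by norm_num)).trans (le_of_eq ?_)
  rw [Finset.sum_const, Finset.card_univ, nsmul_eq_mul]
  ring

/-- The number of times that the output names the coordinate `j`, if `j` is the unique common
element of the inputs, is small on average over `j` if there are few leaves. -/
theorem sum_card_found_le (hleaf : ∀ x y ℓ, leaf x y = ℓ ↔ A ℓ x ∧ B ℓ y) (out : L → ι) :
    ∑ j, ∑ d, (#{z | out (leaf (Function.update (fstPart d z) j true)
        (Function.update (sndPart d z) j true)) = j} : ℝ) ≤
      (4 + 32 * Real.log (Fintype.card L)) * (Fintype.card (ι → Bool) : ℝ) ^ 2 := by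
  have h1 : ∀ j d, (#{z | out (leaf (Function.update (fstPart d z) j true)
        (Function.update (sndPart d z) j true)) = j} : ℝ) =
      ∑ ℓ, if out ℓ = j then leafCount leaf j d true true ℓ else 0 := fun j d => by
    have h : ∀ ℓ, (if out ℓ = j then leafCount leaf j d true true ℓ else 0) =
        ∑ z, if leaf (Function.update (fstPart d z) j true)
          (Function.update (sndPart d z) j true) = ℓ then (if out ℓ = j then 1 else 0) else 0 :=
      fun ℓ => by
        unfold leafCount
        split_ifs <;> simp
    simp only [h]
    rw [Finset.sum_comm]
    simp only [Finset.sum_ite_eq, Finset.mem_univ, if_true]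
    rw [Finset.sum_boole]
  have h2 : ∀ j d, (∑ ℓ, if out ℓ = j then leafCount leaf j d true true ℓ else 0) ≤
      4 * (∑ ℓ, if out ℓ = j then (#{z | leaf (fstPart d z) (sndPart d z) = ℓ} : ℝ) else 0) +
      2 * ∑ ℓ,
        (√(leafCount leaf j d true true ℓ) - √(leafCount leaf j d false false ℓ)) ^ 2 :=
    fun j d => by
      rw [Finset.mul_sum, Finset.mul_sum, ← Finset.sum_add_distrib]
      refine Finset.sum_le_sum fun ℓ _ => ?_
      have e1 := Real.sq_sqrt (leafCount_nonneg leaf j d true true ℓ)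
      have e2 := Real.sq_sqrt (leafCount_nonneg leaf j d false false ℓ)
      have e3 := leafCount_false_false_le leaf j d ℓ
      -- With p, q the planted and unplanted counts, (√p - 2√q)² ≥ 0 reads p ≤ 2q + 2(√p - √q)².
      have e4 := sq_nonneg
        (√(leafCount leaf j d true true ℓ) - 2 * √(leafCount leaf j d false false ℓ))
      split_ifs
      · nlinarith
      · have := sq_nonneg
          (√(leafCount leaf j d true true ℓ) - √(leafCount leaf j d false false ℓ))
        linarith
  -- Each leaf names exactly one j.
  have h3 : ∀ d : ι → Bool, ∑ j, (∑ ℓ, if out ℓ = j then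
      (#{z | leaf (fstPart d z) (sndPart d z) = ℓ} : ℝ) else 0) = Fintype.card (ι → Bool) :=
    fun d => by
      rw [Finset.sum_comm, ← sum_card_fiber (fun z => leaf (fstPart d z) (sndPart d z))]
      refine Finset.sum_congr rfl fun ℓ _ => ?_
      rw [Finset.sum_ite_eq]
      simp
  simp only [h1]
  refine (Finset.sum_le_sum fun j _ => Finset.sum_le_sum fun d _ => h2 j d).trans ?_
  simp only [Finset.sum_add_distrib, ← Finset.mul_sum]
  have h4 := sum_sum_hellinger_diagonal_le hleaf
  rw [Finset.sum_comm (s := univ (α := ι))]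
  simp only [h3]
  rw [Finset.sum_const, Finset.card_univ, nsmul_eq_mul]
  linarith

end UniqueIntersection

/-! ### Rectangles of a protocol tree, and fixing the coins. -/

namespace Protocol

/-- The leaves that a protocol reaches after at most `C` bits form a partition of the inputs into
at most `2 ^ C` rectangles, together with the inputs on which more bits are sent. -/
lemma exists_leaves {X Y OA OB : Type*} [Inhabited OA] (C : ℕ) (T : Protocol X Y OA OB) :
    ∃ (L : Type) (_ : Fintype L) (leaf : X → Y → L) (A : L → X → Prop) (B : L → Y → Prop)
      (out : L → X → OA), Fintype.card L ≤ 2 ^ C ∧ (∀ x y ℓ, leaf x y = ℓ ↔ A ℓ x ∧ B ℓ y) ∧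
      ∀ x y, T.bits x y ≤ C → (T.output x y).1 = out (leaf x y) x := by
  induction C generalizing T with
  | zero =>
    refine ⟨Unit, inferInstance, fun _ _ => (), fun _ _ => True, fun _ _ => True,
      match T with
      | leaf outA _ => fun _ => outA
      -- A node cut off at depth `C` sends a further bit, so the default is never compared with an
      -- actual output.
      | _ => fun _ _ => default, by simp, by simp, fun x y h => ?_⟩
    cases T with
    | leaf outA outB => rfl
    | sendA bit next => simp [bits] at h
    | sendB bit next => simp [bits] at h
  | succ C ih =>
    cases T with
    | leaf outA outB =>
      exact ⟨Unit, inferInstance, fun _ _ => (), fun _ _ => True, fun _ _ => True,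
        fun _ => outA, by simpa using Nat.one_le_two_pow, by simp, fun x y h => rfl⟩
    | sendA bit next =>
      choose L hL leaf A B out hcard hrect hout using fun b => ih (next b)
      refine ⟨Σ b, L b, inferInstance, fun x y => ⟨bit x, leaf (bit x) x y⟩,
        fun ℓ x => bit x = ℓ.1 ∧ A ℓ.1 ℓ.2 x, fun ℓ y => B ℓ.1 ℓ.2 y,
        fun ℓ => out ℓ.1 ℓ.2, ?_, ?_, fun x y h => ?_⟩
      · have h1 := hcard true
        have h2 := hcard false
        simp only [Fintype.card_sigma, Fintype.sum_bool, pow_succ]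
        omega
      · rintro x y ⟨b, ℓ⟩
        constructor
        · intro h
          obtain ⟨rfl, h⟩ := Sigma.mk.inj_iff.1 h
          have := (hrect _ x y ℓ).1 (eq_of_heq h)
          exact ⟨⟨rfl, this.1⟩, this.2⟩
        · rintro ⟨⟨rfl, h1⟩, h2⟩
          simp only
          rw [(hrect _ x y ℓ).2 ⟨h1, h2⟩]
      · simp only [bits] at h
        exact hout _ x y (by omega)
    | sendB bit next =>
      choose L hL leaf A B out hcard hrect hout using fun b => ih (next b)
      refine ⟨Σ b, L b, inferInstance, fun x y => ⟨bit y, leaf (bit y) x y⟩,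
        fun ℓ x => A ℓ.1 ℓ.2 x, fun ℓ y => bit y = ℓ.1 ∧ B ℓ.1 ℓ.2 y,
        fun ℓ => out ℓ.1 ℓ.2, ?_, ?_, fun x y h => ?_⟩
      · have h1 := hcard true
        have h2 := hcard false
        simp only [Fintype.card_sigma, Fintype.sum_bool, pow_succ]
        omega
      · rintro x y ⟨b, ℓ⟩
        constructor
        · intro h
          obtain ⟨rfl, h⟩ := Sigma.mk.inj_iff.1 h
          have := (hrect _ x y ℓ).1 (eq_of_heq h)
          exact ⟨this.1, rfl, this.2⟩
        · rintro ⟨h1, rfl, h2⟩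
          simp only
          rw [(hrect _ x y ℓ).2 ⟨h1, h2⟩]
      · simp only [bits] at h
        exact hout _ x y (by omega)

end Protocol

open Finset in
/-- If each of finitely many events has outer probability at most `δ`, then at some point at most
the fraction `δ` of the events happen. -/
lemma exists_card_filter_le {Ω K : Type*} [MeasurableSpace Ω] (μ : Measure Ω)
    [IsProbabilityMeasure μ] [Fintype K] (E : K → Set Ω) (δ : ℝ≥0∞) (hE : ∀ k, μ (E k) ≤ δ)
    [∀ ω, DecidablePred fun k => ω ∈ E k] :
    ∃ ω, (#{k | ω ∈ E k} : ℝ≥0∞) ≤ Fintype.card K * δ := by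
  classical
  -- The events may be non-measurable; their measurable hulls have the same measure.
  have hmeas : ∀ k, MeasurableSet (toMeasurable μ (E k)) := fun k => measurableSet_toMeasurable _ _
  have hm : Measurable fun ω => ∑ k, (toMeasurable μ (E k)).indicator (fun _ => (1 : ℝ≥0∞)) ω :=
    Finset.measurable_sum _ fun k _ => measurable_const.indicator (hmeas k)
  obtain ⟨ω, hω⟩ := exists_le_lintegral (μ := μ) hm.aemeasurable
  refine ⟨ω, le_trans ?_ (hω.trans ?_)⟩
  · rw [← Finset.sum_boole]
    refine Finset.sum_le_sum fun k _ => ?_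
    split_ifs with h
    · rw [Set.indicator_of_mem (subset_toMeasurable μ _ h)]
    · exact zero_le
  · rw [lintegral_finsetSum _ fun k _ => measurable_const.indicator (hmeas k)]
    simp only [lintegral_indicator_const (hmeas _), measure_toMeasurable, one_mul]
    refine (Finset.sum_le_sum fun k _ => hE k).trans ?_
    rw [Finset.sum_const, Finset.card_univ, nsmul_eq_mul]

/-! ### Equilibria of the 2-cycle game. -/

open Finset in
/-- If the payoff of an action is its mass under the push-forward of a mixed strategy `b` along a
map `f` that is not surjective, then every action that is nearly a best response is the image of
an action in the support of `b`. -/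
lemma exists_eq_of_nearly_best_response {V : Type*} [Fintype V] [DecidableEq V] (f : V → V)
    (b : stdSimplex ℝ V) {u₀ u : V} (h₀ : ∀ v, f v ≠ u₀) {ε : ℝ} (hε : ε ≤ 1 / Fintype.card V)
    (h : ∀ u', ∑ v, b.1 v * ((if f v = u' then 1 else 0) - if f v = u then 1 else 0) ≤ ε) :
    ∃ v, b.1 v ≠ 0 ∧ f v = u := by
  by_contra! hu
  have hpos : (0 : ℝ) < Fintype.card V := by exact_mod_cast Fintype.card_pos_iff.2 ⟨u⟩
  -- Otherwise u earns 0, so all payoffs are at most 1/N; they sum to 1 over N actions, yet u₀ earns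
  -- 0.
  have h1 : ∀ u', ∑ v, b.1 v * (if f v = u' then 1 else 0) ≤ 1 / (Fintype.card V : ℝ) := fun u' => by
    refine le_trans (Finset.sum_le_sum fun v _ => ?_) ((h u').trans hε)
    by_cases hb : b.1 v = 0
    · simp [hb]
    · simp [hu v hb]
  have h2 : ∑ u', ∑ v, b.1 v * (if f v = u' then 1 else 0) = 1 := by
    rw [Finset.sum_comm]
    simp [b.2.2]
  have h3 : ∑ u', ∑ v, b.1 v * (if f v = u' then 1 else 0) < ∑ _u' : V, 1 / (Fintype.card V : ℝ) := by
    refine Finset.sum_lt_sum (fun u' _ => h1 u') ⟨u₀, Finset.mem_univ _, ?_⟩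
    simp only [h₀, if_false, mul_zero, Finset.sum_const_zero]
    positivity
  rw [h2, Finset.sum_const, Finset.card_univ, nsmul_eq_mul, mul_one_div_cancel hpos.ne'] at h3
  exact lt_irrefl _ h3

namespace TwoCycle

open Label

variable {n : ℕ}

/-- The successor of a vertex in the graph `G_A`. -/
def succA (x : ZMod n → Bool) : Vertex n → Vertex n
  | (i, l1) => (i + 1, if x (i + 1) then l11 else l0)
  | (i, l0) => if x i then (i - 1, bitLabel (x (i - 1))) else (i + 1, if x (i + 1) then l01 else l0)
  | (i, l01) => (i, l1)
  | (i, l11) => (i, l1)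

/-- The successor of a vertex in the graph `G_B`. -/
def succB (y : ZMod n → Bool) : Vertex n → Vertex n
  | (i, l1) => (i + 1, if y (i + 1) then l11 else l0)
  | (i, l0) => (i + 1, if y (i + 1) then l01 else l0)
  | (i, l01) => (i, l1)
  | (i, l11) => (i, l1)

lemma mem_edgesA (x : ZMod n → Bool) (v u : Vertex n) : (v, u) ∈ edgesA x ↔ succA x v = u := by
  constructor
  · rintro (((⟨k, h⟩ | ⟨k, hx, h⟩) | ⟨k, hx, h⟩) | ⟨k, h | h⟩) <;>
      obtain ⟨rfl, rfl⟩ := Prod.mk.inj h <;> simp [succA, *]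
  · rintro rfl
    obtain ⟨i, z⟩ := v
    cases z
    · cases hx : x i
      · exact Or.inl (Or.inl (Or.inr ⟨i, hx, by simp [succA, hx]⟩))
      · exact Or.inl (Or.inr ⟨i, hx, by simp [succA, hx]⟩)
    · exact Or.inl (Or.inl (Or.inl ⟨i, rfl⟩))
    · exact Or.inr ⟨i, Or.inl rfl⟩
    · exact Or.inr ⟨i, Or.inr rfl⟩

lemma mem_edgesB (y : ZMod n → Bool) (v u : Vertex n) : (v, u) ∈ edgesB y ↔ succB y v = u := by
  constructor
  · rintro ((⟨k, h⟩ | ⟨k, h⟩) | ⟨k, h | h⟩) <;>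
      obtain ⟨rfl, rfl⟩ := Prod.mk.inj h <;> simp [succB]
  · rintro rfl
    obtain ⟨i, z⟩ := v
    cases z
    · exact Or.inl (Or.inr ⟨i, rfl⟩)
    · exact Or.inl (Or.inl ⟨i, rfl⟩)
    · exact Or.inr ⟨i, Or.inl rfl⟩
    · exact Or.inr ⟨i, Or.inr rfl⟩

lemma succA_eq_l01 {x : ZMod n → Bool} {v : Vertex n} {i : ZMod n}
    (h : succA x v = (i, l01) ∨ succA x v = (i, l11)) : x i = true := by
  obtain ⟨j, z⟩ := v
  rcases h with h | h <;> cases z <;> simp only [succA, bitLabel] at h <;> (try split_ifs at h) <;>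
    simp_all [Prod.ext_iff]

lemma succB_eq_l01 {y : ZMod n → Bool} {v : Vertex n} {i : ZMod n}
    (h : succB y v = (i, l01)) : y i = true := by
  obtain ⟨j, z⟩ := v
  cases z <;> simp only [succB] at h <;> (try split_ifs at h) <;> simp_all [Prod.ext_iff]

-- The inclusions force #S = #T, so both are equalities and the maps are bijections between S and T.
open Finset in
lemma mapsTo_of_subset_image {V : Type*} [DecidableEq V] {S T : Finset V} {f g : V → V}
    (h₁ : S ⊆ T.image f) (h₂ : T ⊆ S.image g) :
    (∀ u ∈ S, g u ∈ T) ∧ (∀ v ∈ T, f v ∈ S) ∧ Set.InjOn (f ∘ g) S := by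
  have c1 := (Finset.card_le_card h₁).trans Finset.card_image_le
  have c2 := (Finset.card_le_card h₂).trans Finset.card_image_le
  have e1 := Finset.eq_of_subset_of_card_le h₁ (Finset.card_image_le.trans c2)
  have e2 := Finset.eq_of_subset_of_card_le h₂ (Finset.card_image_le.trans c1)
  refine ⟨fun u hu => e2 ▸ Finset.mem_image_of_mem g hu,
    fun v hv => e1 ▸ Finset.mem_image_of_mem f hv, ?_⟩
  refine Finset.card_image_iff.1 ?_
  rw [← Finset.image_image, ← e2, ← e1]

/-- If the bits before the index `i` are `x = 0` and `y = 1`, then in every equilibrium player `A`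
plays the vertex before `i`. -/
lemma eq_of_isApproxWSNE [NeZero n] {x y : ZMod n → Bool} {i : ZMod n} (hx : x i = true)
    (hy : y i = false) (huniq : ∀ k, x k = true → y k = false → k = i)
    (hx' : x (i - 1) = false) (hy' : y (i - 1) = true) {ε : ℝ} (hε : ε ≤ 1 / ((4 * n : ℕ) : ℝ))
    {a b : stdSimplex ℝ (Vertex n)} (h : IsApproxWSNE (utilityA x) (utilityB y) ε a b)
    {u : Vertex n} (hu : a.1 u ≠ 0) : u = (i - 1, l0) := by
  classical
  have hcard : Fintype.card (Vertex n) = 4 * n := by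
    rw [Fintype.card_prod, ZMod.card, mul_comm]
    rfl
  rw [← hcard] at hε
  let S : Finset (Vertex n) := {u | a.1 u ≠ 0}
  let T : Finset (Vertex n) := {v | b.1 v ≠ 0}
  have hS : S ⊆ T.image (succA x) := fun u hu => by
    have hu : a.1 u ≠ 0 := by simpa [S] using hu
    obtain ⟨v, hv, rfl⟩ := exists_eq_of_nearly_best_response (succA x) b (u₀ := (i - 1, l01))
      (u := u) (fun v hv => by simp [succA_eq_l01 (Or.inl hv)] at hx') hε fun u' => by
        simpa only [utilityA, mem_edgesA] using h.1 u hu u'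
    exact Finset.mem_image_of_mem _ (by simpa [T] using hv)
  have hT : T ⊆ S.image (succB y) := fun v hv => by
    have hv : b.1 v ≠ 0 := by simpa [T] using hv
    obtain ⟨u, hu, rfl⟩ := exists_eq_of_nearly_best_response (succB y) a (u₀ := (i, l01))
      (u := v) (fun v hv => by simp [succB_eq_l01 hv] at hy) hε fun u' => by
        simpa only [utilityB, mem_edgesB] using h.2 v hv u'
    exact Finset.mem_image_of_mem _ (by simpa [S] using hu)
  obtain ⟨hg, hf, hinj⟩ := mapsTo_of_subset_image hS hT
  have hfix : succA x (succB y (i - 1, l0)) = (i - 1, l0) := by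
    simp [succB, succA, hx, hy, hx', bitLabel]
  have hpull : ∀ u ∈ S, succA x (succB y u) = (i - 1, l0) → u = (i - 1, l0) := fun u hu h => by
    refine hinj hu ?_ (h.trans hfix.symm)
    have := hf _ (hg u hu)
    rwa [h] at this
  -- Induction on the number k of steps from the index of u forward to i - 1. The composite map
  -- either lowers k or hits the fixed vertex, and injectivity pulls the conclusion back to u.
  suffices H : ∀ k : ℕ, ∀ u ∈ S, u.1 + k = i - 1 → u = (i - 1, l0) by
    refine H (i - 1 - u.1).val u (by simpa [S] using hu) ?_
    rw [ZMod.natCast_zmod_val]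
    ring
  intro k
  induction k using Nat.strong_induction_on with
  | _ k ih =>
    rintro ⟨j, z⟩ hu hk
    simp only at hk
    have hu' := hf _ (hg _ hu)
    refine hpull _ hu ?_
    have hAimage : ∀ z, z = l01 ∨ z = l11 → (j, z) ∈ S → x j = true := fun z hz hz' => by
      obtain ⟨v, -, hv⟩ := Finset.mem_image.1 (hS hz')
      exact succA_eq_l01 (v := v) (by rcases hz with rfl | rfl <;> simp [hv])
    -- No overshoot at k = 0: these labels need x = 1, but x is 0 at i - 1.
    have hlate : z = l01 ∨ z = l11 → succA x (succB y (j, z)) = (i - 1, l0) := fun hz => by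
      have hxj := hAimage z hz hu
      have hstep : (succA x (succB y (j, z))).1 = j + 1 := by
        rcases hz with rfl | rfl <;> simp [succB, succA]
      rcases k with _ | k
      · simp only [Nat.cast_zero, add_zero] at hk
        rw [hk, hx'] at hxj
        simp at hxj
      · refine ih k (by omega) _ hu' ?_
        rw [hstep, ← hk]
        push_cast
        ring
    -- A move by two needs x = y = 0 at j + 1, which the bits at i and i - 1 exclude for k = 0 and k
    -- = 1. The pair (1,0) occurs only at i and leads straight to the fixed vertex. A move by one
    -- needs y = 1 at j + 1, impossible for k = 0.
    have hearly : z = l0 ∨ z = l1 → succA x (succB y (j, z)) = (i - 1, l0) := fun hz => by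
      cases hyj : y (j + 1)
      · have hv : succB y (j, z) = (j + 1, l0) := by rcases hz with rfl | rfl <;> simp [succB, hyj]
        rw [hv] at hu' ⊢
        cases hxj : x (j + 1)
        · have hstep : (succA x (j + 1, l0)).1 = j + 1 + 1 := by simp [succA, hxj]
          rcases k with _ | _ | k
          · simp only [Nat.cast_zero, add_zero] at hk
            rw [hk, sub_add_cancel, hx] at hxj
            simp at hxj
          · simp only [zero_add, Nat.cast_one] at hk
            rw [hk, hy'] at hyj
            simp at hyj
          · refine ih k (by omega) _ hu' ?_
            rw [hstep, ← hk]
            push_cast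
            ring
        · rw [← huniq _ hxj hyj]
          have : j = i - 1 := by rw [← huniq _ hxj hyj]; ring
          rw [← this] at hx'
          simp [succA, hxj, hx', bitLabel]
      · have hv : succA x (succB y (j, z)) = (j + 1, l1) := by
          rcases hz with rfl | rfl <;> simp [succB, succA, hyj]
        rw [hv] at hu' ⊢
        rcases k with _ | k
        · simp only [Nat.cast_zero, add_zero] at hk
          rw [hk, sub_add_cancel, hy] at hyj
          simp at hyj
        · refine ih k (by omega) _ hu' ?_
          rw [← hk]
          push_cast
          ring
    cases z
    · exact hearly (Or.inl rfl)
    · exact hearly (Or.inr rfl)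
    · exact hlate (Or.inl rfl)
    · exact hlate (Or.inr rfl)

end TwoCycle

/-! ### Embedding set intersection, and the final count. -/

namespace TwoCycle

open UniqueIntersection

variable {n : ℕ}

/-- The string that has the bits of `x` at the odd positions and `c` elsewhere. -/
def interleave (c : Bool) (x : Fin (n / 2) → Bool) (i : ZMod n) : Bool :=
  if h : i.val % 2 = 1 ∧ i.val / 2 < n / 2 then x ⟨i.val / 2, h.2⟩ else c

/-- The odd position of the `k`-th bit in an interleaved string. -/
def oddPos (k : Fin (n / 2)) : ZMod n := ((2 * k.1 + 1 : ℕ) : ZMod n)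

lemma val_oddPos (k : Fin (n / 2)) : (oddPos k : ZMod n).val = 2 * k.1 + 1 :=
  ZMod.val_natCast_of_lt (by have := k.2; omega)

lemma oddPos_injective : Function.Injective (oddPos : Fin (n / 2) → ZMod n) := fun k l h => by
  have := congrArg ZMod.val h
  rw [val_oddPos, val_oddPos] at this
  ext
  omega

lemma interleave_oddPos (c : Bool) (x : Fin (n / 2) → Bool) (k : Fin (n / 2)) :
    interleave c x (oddPos k : ZMod n) = x k := by
  have h : (2 * k.1 + 1) / 2 = k.1 := by omega
  simp [interleave, val_oddPos, h]

lemma interleave_oddPos_sub_one (c : Bool) (x : Fin (n / 2) → Bool) (k : Fin (n / 2)) :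
    interleave c x (oddPos k - 1 : ZMod n) = c := by
  have h : (oddPos k - 1 : ZMod n) = ((2 * k.1 : ℕ) : ZMod n) := by
    rw [oddPos]
    push_cast
    ring
  have hval : ((2 * k.1 : ℕ) : ZMod n).val = 2 * k.1 :=
    ZMod.val_natCast_of_lt (by have := k.2; omega)
  rw [h, interleave, dif_neg (by rw [hval]; omega)]

lemma exists_oddPos_eq [NeZero n] {x y : Fin (n / 2) → Bool} {i : ZMod n}
    (hx : interleave false x i = true) : ∃ k, i = oddPos k ∧ interleave true y i = y k := by
  unfold interleave at hx
  split_ifs at hx with h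
  have : i = oddPos ⟨i.val / 2, h.2⟩ := by
    apply ZMod.val_injective
    rw [val_oddPos]
    simp only
    omega
  exact ⟨_, this, by rw [interleave, dif_pos h]⟩

/-- The index that a mixed strategy in an equilibrium of an interleaved game reveals. -/
noncomputable def revealedIndex [Nonempty (Fin (n / 2))] [NeZero n]
    (a : stdSimplex ℝ (Vertex n)) : Fin (n / 2) :=
  Classical.epsilon fun k => ∀ u, a.1 u ≠ 0 → u = (oddPos k - 1, Label.l0)

lemma revealedIndex_eq [Nonempty (Fin (n / 2))] [NeZero n] {a : stdSimplex ℝ (Vertex n)}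
    {k : Fin (n / 2)} (h : ∀ u, a.1 u ≠ 0 → u = (oddPos k - 1, Label.l0)) :
    revealedIndex a = k := by
  have hspec : ∀ u, a.1 u ≠ 0 → u = (oddPos (revealedIndex a) - 1, Label.l0) :=
    Classical.epsilon_spec (p := fun k => ∀ u, a.1 u ≠ 0 → u = (oddPos k - 1, Label.l0)) ⟨k, h⟩
  obtain ⟨u, hu⟩ : ∃ u, a.1 u ≠ 0 := by
    by_contra! h0
    have := a.2.2
    simp [h0] at this
  have e := (hspec u hu).symm.trans (h u hu)
  exact oddPos_injective (sub_left_injective (Prod.mk.inj e).1)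

/-- The first string of the game of a set-intersection instance. -/
def gameX (n : ℕ) (x : Fin (n / 2) → Bool) : ZMod n → Bool := interleave false x

/-- The second string of the game of a set-intersection instance. -/
def gameY (n : ℕ) (y : Fin (n / 2) → Bool) : ZMod n → Bool := interleave true fun k => !y k

lemma eq_oddPos [NeZero n] {x y : Fin (n / 2) → Bool} {j : Fin (n / 2)}
    (huniq : ∀ k, x k = true → y k = true → k = j) {i : ZMod n} (hi : gameX n x i = true)
    (hi' : gameY n y i = false) : i = oddPos j := by
  obtain ⟨k, rfl, hk⟩ := exists_oddPos_eq (y := fun k => !y k) hi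
  rw [gameX, interleave_oddPos] at hi
  rw [gameY, hk] at hi'
  rw [huniq k hi (by simpa using hi')]

lemma isGame_of_unique [NeZero n] {x y : Fin (n / 2) → Bool} {j : Fin (n / 2)} (hx : x j = true)
    (hy : y j = true) (huniq : ∀ k, x k = true → y k = true → k = j) :
    IsGame n (utilityA (gameX n x)) (utilityB (gameY n y)) :=
  ⟨_, _, ⟨oddPos j, ⟨by rw [gameX, interleave_oddPos, hx], by simp [gameY, interleave_oddPos, hy]⟩,
    fun _ hi => eq_oddPos huniq hi.1 hi.2⟩, rfl, rfl⟩

lemma revealedIndex_of_isApproxWSNE [Nonempty (Fin (n / 2))] [NeZero n] {x y : Fin (n / 2) → Bool}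
    {j : Fin (n / 2)} (hx : x j = true) (hy : y j = true)
    (huniq : ∀ k, x k = true → y k = true → k = j) {ε : ℝ} (hε : ε ≤ 1 / ((4 * n : ℕ) : ℝ))
    {a b : stdSimplex ℝ (Vertex n)}
    (h : IsApproxWSNE (utilityA (gameX n x)) (utilityB (gameY n y)) ε a b) :
    revealedIndex a = j :=
  revealedIndex_eq fun _ hu => eq_of_isApproxWSNE (by rw [gameX, interleave_oddPos, hx])
    (by simp [gameY, interleave_oddPos, hy]) (fun _ => eq_oddPos huniq)
    (interleave_oddPos_sub_one _ _ _) (interleave_oddPos_sub_one _ _ _) hε h hu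

lemma update_part_unique {ι : Type*} [DecidableEq ι] (j : ι) (d z : ι → Bool) (k : ι)
    (hx : Function.update (fstPart d z) j true k = true)
    (hy : Function.update (sndPart d z) j true k = true) : k = j := by
  by_contra hk
  rw [Function.update_of_ne hk] at hx hy
  simp only [fstPart, sndPart, Bool.and_eq_true, Bool.not_eq_true'] at hx hy
  simp [hx.1] at hy

open Finset in
/-- A protocol that finds equilibria of 2-cycle games has many leaves. -/
lemma card_le_log_of_solves [Nonempty (Fin (n / 2))] [NeZero n] {ε : ℝ}
    (hε : ε ≤ 1 / ((4 * n : ℕ) : ℝ))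
    (π : RandomizedProtocol.{u} (Vertex n → Vertex n → ℝ) (Vertex n → Vertex n → ℝ)
      (stdSimplex ℝ (Vertex n)) (stdSimplex ℝ (Vertex n)))
    (hπ : π.Solves (IsGame n) (fun uA uB a b => IsApproxWSNE uA uB ε a b) (1 / 3)) {C : ℕ}
    (hC : π.UsesAtMost (IsGame n) C) :
    2 * ((n / 2 : ℕ) : ℝ) ≤ 3 * (4 + 32 * Real.log (2 ^ C * (n / 2 : ℕ))) := by
  classical
  let ι := Fin (n / 2)
  let K := ι × (ι → Bool) × (ι → Bool)
  let X : K → ι → Bool := fun k => Function.update (fstPart k.2.1 k.2.2) k.1 true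
  let Y : K → ι → Bool := fun k => Function.update (sndPart k.2.1 k.2.2) k.1 true
  have hX : ∀ k, X k k.1 = true := fun k => Function.update_self _ _ _
  have hY : ∀ k, Y k k.1 = true := fun k => Function.update_self _ _ _
  have huniq : ∀ k i, X k i = true → Y k i = true → i = k.1 := fun k => update_part_unique _ _ _
  have hgame : ∀ k, IsGame n (utilityA (gameX n (X k))) (utilityB (gameY n (Y k))) := fun k =>
    isGame_of_unique (hX k) (hY k) (huniq k)
  let E : K → Set (π.Ω × π.ΩA × π.ΩB) := fun k =>
    {ω | ¬ IsApproxWSNE (utilityA (gameX n (X k))) (utilityB (gameY n (Y k))) ε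
      (π.output (utilityA (gameX n (X k))) (utilityB (gameY n (Y k))) ω).1
      (π.output (utilityA (gameX n (X k))) (utilityB (gameY n (Y k))) ω).2}
  have : IsProbabilityMeasure π.coinLaw := by unfold RandomizedProtocol.coinLaw; infer_instance
  obtain ⟨ω, hω⟩ := exists_card_filter_le π.coinLaw E (1 / 3) fun k => hπ _ _ (hgame k)
  have hfail : (3 * #{k | ω ∈ E k} : ℝ) ≤ Fintype.card K := by
    have h := mul_le_mul_left hω 3
    rw [mul_assoc, ENNReal.div_mul_cancel (by norm_num) (by norm_num), mul_one] at h
    rw [mul_comm]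
    exact_mod_cast h
  have : Inhabited (stdSimplex ℝ (Vertex n)) := ⟨(π.output (fun _ _ => 0) (fun _ _ => 0) ω).1⟩
  -- Cutting the tree at depth `C` matters: the argument also runs it on disjoint sets, which
  -- violate the promise, so no bound on the bits holds there.
  obtain ⟨L, _, leaf, A, B, out, hcard, hrect, hout⟩ := (π.tree ω.1).exists_leaves C
  let inA : (ι → Bool) → (Vertex n → Vertex n → ℝ) × π.ΩA := fun x => (utilityA (gameX n x), ω.2.1)
  let inB : (ι → Bool) → (Vertex n → Vertex n → ℝ) × π.ΩB := fun y => (utilityB (gameY n y), ω.2.2)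
  -- The output of `A` depends on its input as well as the leaf. Splitting leaves by the revealed
  -- index keeps them rectangles and costs a factor n / 2.
  let leaf' : (ι → Bool) → (ι → Bool) → L × ι := fun x y =>
    (leaf (inA x) (inB y), revealedIndex (out (leaf (inA x) (inB y)) (inA x)))
  have hleaf' : ∀ x y ℓ, leaf' x y = ℓ ↔
      (A ℓ.1 (inA x) ∧ revealedIndex (out ℓ.1 (inA x)) = ℓ.2) ∧ B ℓ.1 (inB y) := by
    rintro x y ⟨ℓ, i⟩
    simp only [leaf', Prod.mk.injEq]
    constructor
    · rintro ⟨rfl, rfl⟩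
      have := (hrect (inA x) (inB y) _).1 rfl
      exact ⟨⟨this.1, rfl⟩, this.2⟩
    · rintro ⟨⟨h1, rfl⟩, h2⟩
      have := (hrect _ _ _).2 ⟨h1, h2⟩
      exact ⟨this, by rw [this]⟩
  have hfound := sum_card_found_le (A := fun ℓ x => A ℓ.1 (inA x) ∧
    revealedIndex (out ℓ.1 (inA x)) = ℓ.2) (B := fun ℓ y => B ℓ.1 (inB y)) hleaf' Prod.snd
  have hsucc : ∀ k, ω ∉ E k → (leaf' (X k) (Y k)).2 = k.1 := fun k hk => by
    have h1 := revealedIndex_of_isApproxWSNE (hX k) (hY k) (huniq k) hε (not_not.1 hk)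
    have h2 := hout (inA (X k)) (inB (Y k)) (hC _ _ (hgame k) ω)
    simp only [leaf']
    rw [← h2]
    exact h1
  have hcount : (Fintype.card K : ℝ) - #{k | ω ∈ E k} ≤
      #{k : K | (leaf' (X k) (Y k)).2 = k.1} := by
    have h1 := Finset.card_filter_add_card_filter_not (s := (univ : Finset K)) (fun k => ω ∈ E k)
    have h2 : #{k : K | ω ∉ E k} ≤ #{k : K | (leaf' (X k) (Y k)).2 = k.1} :=
      Finset.card_le_card fun k hk => by
        simp only [Finset.mem_filter, Finset.mem_univ, true_and] at hk ⊢
        exact hsucc k hk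
    rw [Finset.card_univ] at h1
    have h3 : Fintype.card K ≤ #{k | ω ∈ E k} + #{k : K | (leaf' (X k) (Y k)).2 = k.1} := by omega
    have : (Fintype.card K : ℝ) ≤ #{k | ω ∈ E k} + #{k : K | (leaf' (X k) (Y k)).2 = k.1} := by
      exact_mod_cast h3
    linarith
  have hsum : (#{k : K | (leaf' (X k) (Y k)).2 = k.1} : ℝ) =
      ∑ j, ∑ d, (#{z | (leaf' (Function.update (fstPart d z) j true)
        (Function.update (sndPart d z) j true)).2 = j} : ℝ) := by
    simp only [← Finset.sum_boole]
    rw [Fintype.sum_prod_type]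
    refine Finset.sum_congr rfl fun j _ => ?_
    rw [Fintype.sum_prod_type]
  rw [← hsum] at hfound
  set N : ℝ := ((Fintype.card (ι → Bool) : ℕ) : ℝ) with hN
  have hNpos : 0 < N := by rw [hN]; exact_mod_cast Fintype.card_pos
  have hK : (Fintype.card K : ℝ) = (n / 2 : ℕ) * N ^ 2 := by
    rw [Fintype.card_prod, Fintype.card_prod, Fintype.card_fin]
    push_cast
    ring
  have hmpos : 0 < n / 2 := Fin.pos_iff_nonempty.2 inferInstance
  have hlog : Real.log (Fintype.card (L × ι)) ≤ Real.log (2 ^ C * (n / 2 : ℕ)) := by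
    have : Nonempty (L × ι) := ⟨leaf' (fun _ => false) fun _ => false⟩
    refine Real.log_le_log (by exact_mod_cast Fintype.card_pos) ?_
    rw [Fintype.card_prod, Fintype.card_fin]
    exact_mod_cast Nat.mul_le_mul_right _ hcard
  have hfin : N ^ 2 * (2 * ((n / 2 : ℕ) : ℝ)) ≤
      N ^ 2 * (3 * (4 + 32 * Real.log (Fintype.card (L × ι)))) := by
    rw [hK] at hcount hfail
    linarith
  have := le_of_mul_le_mul_left hfin (by positivity)
  linarith

/-- The tangent at 256 has slope small enough for 96 log m to be absorbed by 2m. -/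
lemma log_le_div_add (m : ℝ) (hm : 0 < m) : Real.log m ≤ m / 256 + 5 := by
  have h1 := Real.log_le_sub_one_of_pos (x := m / 256) (by positivity)
  rw [Real.log_div hm.ne' (by norm_num)] at h1
  have h2 : Real.log 256 = 8 * Real.log 2 := by
    rw [show (256 : ℝ) = 2 ^ 8 by norm_num, Real.log_pow]
    norm_num
  have := Real.log_two_lt_d9
  linarith

end TwoCycle

theorem theorem4 :
    ∃ c : ℝ, 0 < c ∧ ∃ n₀ : ℕ, ∀ (n : ℕ) [NeZero n], 3 ≤ n → n₀ ≤ n →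
      ∀ ε : ℝ, 0 ≤ ε → ε ≤ 1 / ((4 * n : ℕ) : ℝ) →
      ∀ π : RandomizedProtocol.{u}
          (TwoCycle.Vertex n → TwoCycle.Vertex n → ℝ) (TwoCycle.Vertex n → TwoCycle.Vertex n → ℝ)
          (stdSimplex ℝ (TwoCycle.Vertex n)) (stdSimplex ℝ (TwoCycle.Vertex n)),
        π.Solves (TwoCycle.IsGame n) (fun uA uB a b => IsApproxWSNE uA uB ε a b) (1 / 3) →
        ∀ C : ℕ, π.UsesAtMost (TwoCycle.IsGame n) C → c * ((4 * n : ℕ) : ℝ) ≤ (C : ℝ) := by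
  -- With m = n / 2, the count gives 96 C ≥ (2 - 96/256) m - 492. For m ≥ 1000 and n ≤ 3m this
  -- exceeds 96 n / 300.
  refine ⟨1 / 1200, by norm_num, 2000, fun n _ _ hn ε _ hε π hπ C hC => ?_⟩
  have hm : 1000 ≤ n / 2 := by omega
  have hnm : n ≤ 3 * (n / 2) := by omega
  have : Nonempty (Fin (n / 2)) := ⟨⟨0, by omega⟩⟩
  have h := TwoCycle.card_le_log_of_solves hε π hπ hC
  have hm' : (1000 : ℝ) ≤ (n / 2 : ℕ) := by exact_mod_cast hm
  have hnm' : (n : ℝ) ≤ 3 * (n / 2 : ℕ) := by exact_mod_cast hnm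
  rw [Real.log_mul (by positivity) (by positivity), Real.log_pow] at h
  have h1 := TwoCycle.log_le_div_add (n / 2 : ℕ) (by linarith)
  have h2 : (C : ℝ) * Real.log 2 ≤ C := by
    have := Real.log_two_lt_d9
    exact mul_le_of_le_one_right (Nat.cast_nonneg C) (by linarith)
  push_cast at *
  linarith
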